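/- Let $B\in\mathbb{R}^{n\times n}$ be an irreducible (entrywise) nonnegative matrix with spectral radius $\rho(B)$, let $0<\gamma<1$, and let $\|\cdot\|$ be the Euclidean norm. For vectors write $\min(\mathbf v)=\min_i \mathbf v^{(i)}$, $\min(\mathbf w/\mathbf v)=\min_i \mathbf w^{(i)}/\mathbf v^{(i)}$ and $\max(\mathbf w/\mathbf v)=\max_i \mathbf w^{(i)}/\mathbf v^{(i)}$. Consider any infinite run of the inexact Noda iteration INI_1: $\mathbf x_0>\mathbf 0$ is an arbitrary vector with $\|\mathbf x_0\|=1$, $\overline\lambda_0=\max(B\mathbf x_0/\mathbf x_0)$, and for all $k\ge 0$ $$(\overline\lambda_k I-B)\mathbf y_{k+1}=\mathbf x_k+\mathbf f_k\ \text{ with }\ \|\mathbf f_k\|\le\gamma\min(\mathbf x_k),\qquad \mathbf x_{k+1}=\frac{\mathbf y_{k+1}}{\|\mathbf y_{k+1}\|},\qquad \overline\lambda_{k+1}=\overline\lambda_k-\min\left(\frac{\mathbf x_k+\mathbf f_k}{\mathbf y_{k+1}}\right).$$ Let $\varepsilon_k=\overline\lambda_k-\rho(B)$ and $\rho_k=\varepsilon_{k+1}/\varepsilon_k$.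 Then $\varepsilon_k>0$ for all $k$ (so $\rho_k$ is well defined), and $$\limsup_{k\to\infty}\rho_k\le\frac{2\gamma}{1+\gamma}<1.$$ Hence INI_1 converges globally and at least linearly, with asymptotic factor bounded by $2\gamma/(1+\gamma)$: $\overline\lambda_k\to\rho(B)$, and for every $q>2\gamma/(1+\gamma)$ one has $\varepsilon_{k+1}\le q\,\varepsilon_k$ for all sufficiently large $k$. -/

import Mathlib

open Filter Topology Matrix

noncomputable section

namespace Noda

/-- The spectral radius `ρ(B)` of a real square matrix: the largest modulus of its complex
eigenvalues. -/
def rho {n : ℕ} (B : Matrix (Fin n) (Fin n) ℝ) : ℝ :=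
  (spectralRadius ℂ (B.map (algebraMap ℝ ℂ))).toReal

/-- The Euclidean norm of a vector. -/
def norm2 {n : ℕ} (v : Fin n → ℝ) : ℝ := ‖WithLp.toLp 2 v‖

/-- `min(v)`, the smallest entry of a vector. -/
def minEntry {n : ℕ} (v : Fin n → ℝ) : ℝ := ⨅ i, v i

/-- `max(w / v)`, the largest entrywise quotient. -/
def maxQuot {n : ℕ} (w v : Fin n → ℝ) : ℝ := ⨆ i, w i / v i

/-- `min(w / v)`, the smallest entrywise quotient. -/
def minQuot {n : ℕ} (w v : Fin n → ℝ) : ℝ := ⨅ i, w i / v i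

/-- An infinite run of the inexact Noda iteration with inner tolerance `γ min(x_k)` for the
matrix `B`: `x k` are the approximate eigenvectors, `y (k + 1)` the approximate solutions of the
inner linear systems, `f k` their residuals, and `lam k` the approximate eigenvalues
(the value `y 0` plays no role).
Nothing but the starting vector is required to be positive; positivity of all later iterates
and nonsingularity of `lam k • 1 - B` are consequences for irreducible nonnegative `B`. -/
structure IsINI1 {n : ℕ} (B : Matrix (Fin n) (Fin n) ℝ) (γ : ℝ)
    (x y f : ℕ → Fin n → ℝ) (lam : ℕ → ℝ) : Prop where
  x_zero_pos : ∀ i, 0 < x 0 i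
  x_zero_unit : norm2 (x 0) = 1
  lam_zero : lam 0 = maxQuot (B *ᵥ x 0) (x 0)
  inner_system : ∀ k, (lam k • (1 : Matrix (Fin n) (Fin n) ℝ) - B) *ᵥ y (k + 1) = x k + f k
  inner_tol : ∀ k, norm2 (f k) ≤ γ * minEntry (x k)
  normalize : ∀ k, x (k + 1) = (norm2 (y (k + 1)))⁻¹ • y (k + 1)
  lam_succ : ∀ k, lam (k + 1) = lam k - minQuot (x k + f k) (y (k + 1))

/-- The eigenvalue error `ε_k = lam_k - ρ(B)`. -/
def err {n : ℕ} (B : Matrix (Fin n) (Fin n) ℝ) (lam : ℕ → ℝ) (k : ℕ) : ℝ := lam k - rho B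

/-- The error ratio `ρ_k = ε_{k+1} / ε_k`. -/
def ratio {n : ℕ} (B : Matrix (Fin n) (Fin n) ℝ) (lam : ℕ → ℝ) (k : ℕ) : ℝ :=
  err B lam (k + 1) / err B lam k

end Noda

end

/-!
The proof works throughout with entrywise quotients by the Perron vector `v > 0`, `B v = r v`,
and never uses the resolvent of `B`. Its existence is proved by minimizing `r` subject to
`B x ≤ r x` on the standard simplex (`Noda.exists_perron_vector`), and `r` is identified with the
spectral radius by comparing moduli of complex eigenvectors with `v`
(`Noda.spectralRadius_eq_of_eigenvector`).

Along a run, every `x k` is a positive unit vector with `B (x k) ≤ lam k • x k`, so `lam k ≥ r` by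
Collatz–Wielandt; equality is impossible because `(r I - B) y = g` has no solution with `g > 0`
(`Noda.IsINI1.invariant`). If `a v ≤ x k ≤ b v`, then the right-hand side `x k + f k` lies between
`(1 - γ) a v` and `(1 + γ) b v`, the solution satisfies `y (k + 1) ≤ (1 + γ) b / ε_k • v`, and hence
`ε_{k+1} ≤ (1 - (1 - γ) / (1 + γ) * (a / b)) ε_k` (`Noda.IsINI1.contraction`).

This contraction is used twice. By irreducibility, the nonnegative unit vectors with
`B x ≤ lam 0 • x` form a compact set of positive vectors, so `a / b` is bounded below and `ε_k → 0`
(`Noda.IsINI1.tendsto_lam`). Then cluster points of `x k` satisfy `B z ≤ r z`, which forces `z = v`,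
so `x k → v`, `a / b` can be taken arbitrarily close to `1`, and the factor tends to
`1 - (1 - γ) / (1 + γ) = 2 γ / (1 + γ)` (`Noda.IsINI1.eventually_le`).
-/

namespace Noda

/-! ### Comparison with a positive vector -/

section Comparison

variable {ι : Type*} [Fintype ι]

/-- The maximum `t` of the quotients `u / v` for a positive vector `v`, in the division-free form
in which it is used: `u ≤ t v`, with equality in some entry. -/
lemma exists_le_mul_eq [Nonempty ι] {v : ι → ℝ} (hv : ∀ i, 0 < v i) (u : ι → ℝ) :
    ∃ (t : ℝ) (i : ι), (∀ j, u j ≤ t * v j) ∧ u i = t * v i := by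
  obtain ⟨i, hi⟩ := Finite.exists_max fun j => u j / v j
  refine ⟨u i / v i, i, fun j => ?_, ?_⟩
  · exact (div_le_iff₀ (hv j)).1 (hi j)
  · exact (div_mul_cancel₀ _ (hv i).ne').symm

lemma exists_mul_le_eq [Nonempty ι] {v : ι → ℝ} (hv : ∀ i, 0 < v i) (u : ι → ℝ) :
    ∃ (t : ℝ) (i : ι), (∀ j, t * v j ≤ u j) ∧ u i = t * v i := by
  obtain ⟨i, hi⟩ := Finite.exists_min fun j => u j / v j
  refine ⟨u i / v i, i, fun j => ?_, ?_⟩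
  · exact (le_div_iff₀ (hv j)).1 (hi j)
  · exact (div_mul_cancel₀ _ (hv i).ne').symm

variable {B : Matrix ι ι ℝ}

lemma mulVec_mono_apply (hB : ∀ i j, 0 ≤ B i j) {u w : ι → ℝ} (h : ∀ i, u i ≤ w i) (i : ι) :
    (B *ᵥ u) i ≤ (B *ᵥ w) i :=
  Finset.sum_le_sum fun j _ => mul_le_mul_of_nonneg_left (h j) (hB i j)

lemma mulVec_nonneg_apply (hB : ∀ i j, 0 ≤ B i j) {u : ι → ℝ} (h : ∀ i, 0 ≤ u i) (i : ι) :
    0 ≤ (B *ᵥ u) i :=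
  Finset.sum_nonneg fun j _ => mul_nonneg (hB i j) (h j)

lemma mulVec_pos_apply {i j : ι} (hB : ∀ j, 0 ≤ B i j) {u : ι → ℝ} (h : ∀ i, 0 ≤ u i)
    (hij : 0 < B i j) (hj : 0 < u j) : 0 < (B *ᵥ u) i :=
  Finset.sum_pos' (fun l _ => mul_nonneg (hB l) (h l)) ⟨j, Finset.mem_univ j, mul_pos hij hj⟩

lemma mulVec_mul_apply_of_eigenvector {v : ι → ℝ} {r : ℝ} (hv : B *ᵥ v = r • v) (t : ℝ) (i : ι) :
    (B *ᵥ fun j => t * v j) i = t * (r * v i) := by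
  have : (fun j => t * v j) = t • v := rfl
  rw [this, mulVec_smul, hv]; rfl

/-- The upper half of the Collatz–Wielandt characterization. -/
lemma le_of_mulVec_le [Nonempty ι] (hB : ∀ i j, 0 ≤ B i j) {v : ι → ℝ} {r : ℝ}
    (hvpos : ∀ i, 0 < v i) (hv : B *ᵥ v = r • v) {x : ι → ℝ} (hx : ∀ i, 0 < x i) {l : ℝ}
    (h : ∀ i, (B *ᵥ x) i ≤ l * x i) : r ≤ l := by
  obtain ⟨t, i, hle, heq⟩ := exists_mul_le_eq hvpos x
  have h1 := mulVec_mono_apply hB hle i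
  rw [mulVec_mul_apply_of_eigenvector hv] at h1
  have h2 := h i
  have h3 : 0 < t * v i := heq ▸ hx i
  rw [heq] at h2
  nlinarith

end Comparison

/-! ### Perron–Frobenius theory -/

section Perron

variable {ι : Type*} [Fintype ι] [DecidableEq ι] {B : Matrix ι ι ℝ}

/-- A nonnegative `z ≠ 0` with `B z ≤ l z` has no zero entry when `B` is irreducible: iterating
gives `B ^ k z ≤ l ^ k z`, and every pair of indices is linked by a positive entry of a power. -/
lemma pos_of_mulVec_le (hB : B.IsIrreducible) {z : ι → ℝ} (hz : ∀ i, 0 ≤ z i) (hz0 : z ≠ 0)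
    {l : ℝ} (h : ∀ i, (B *ᵥ z) i ≤ l * z i) (i : ι) : 0 < z i := by
  obtain ⟨j, hj⟩ := Function.ne_iff.1 hz0
  have hj : 0 < z j := lt_of_le_of_ne (hz j) (Ne.symm hj)
  obtain ⟨k, -, hk⟩ := (isIrreducible_iff_exists_pow_pos hB.nonneg).1 hB i j
  have key : ∀ (k : ℕ) (i : ι), (B ^ k *ᵥ z) i ≤ |l| ^ k * z i := by
    intro k
    induction k with
    | zero => simp
    | succ k ih =>
      intro i
      rw [pow_succ', ← mulVec_mulVec]
      calc (B *ᵥ (B ^ k *ᵥ z)) i ≤ (B *ᵥ (|l| ^ k • z)) i :=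
            mulVec_mono_apply hB.nonneg ih i
        _ = |l| ^ k * (B *ᵥ z) i := by rw [mulVec_smul]; rfl
        _ ≤ |l| ^ k * (|l| * z i) := by
            gcongr
            exact (h i).trans (mul_le_mul_of_nonneg_right (le_abs_self l) (hz i))
        _ = |l| ^ (k + 1) * z i := by ring
  have h1 : 0 < (B ^ k *ᵥ z) i :=
    mulVec_pos_apply (fun l => pow_apply_nonneg hB.nonneg k i l) hz hk hj
  have h2 := h1.trans_le (key k i)
  exact lt_of_le_of_ne (hz i) fun h0 => by simp [← h0] at h2

lemma exists_commute_pos (hB : B.IsIrreducible) :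
    ∃ P : Matrix ι ι ℝ, Commute B P ∧ ∀ i j, 0 < P i j := by
  choose k _ hk using (isIrreducible_iff_exists_pow_pos hB.nonneg).1 hB
  refine ⟨∑ i, ∑ j, B ^ k i j, ?_, fun i j => ?_⟩
  · exact Commute.sum_right _ _ _ fun i _ => Commute.sum_right _ _ _ fun j _ =>
      (Commute.refl B).pow_right _
  · rw [Matrix.sum_apply]
    have hnn : ∀ a b, 0 ≤ (B ^ k a b) i j := fun a b => pow_apply_nonneg hB.nonneg _ i j
    refine Finset.sum_pos' (fun a _ => ?_) ⟨i, Finset.mem_univ i, ?_⟩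
    · rw [Matrix.sum_apply]; exact Finset.sum_nonneg fun b _ => hnn a b
    · rw [Matrix.sum_apply]
      exact Finset.sum_pos' (fun b _ => hnn i b) ⟨j, Finset.mem_univ j, hk i j⟩

/-- Existence of a Perron vector. The eigenvalue is the least `r` for which `B x ≤ r x` has a
solution in the standard simplex. If `B x ≠ r x` for a minimizer `x`, then multiplication by a
positive matrix commuting with `B` makes the inequality strict in every entry, and `r` was not
minimal. -/
theorem exists_perron_vector [Nonempty ι] (hB : B.IsIrreducible) :
    ∃ (r : ℝ) (v : ι → ℝ), (∀ i, 0 < v i) ∧ B *ᵥ v = r • v := by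
  let R : ℝ := ∑ i, ∑ j, B i j
  let S : Set (ℝ × (ι → ℝ)) :=
    (Set.Icc 0 R ×ˢ stdSimplex ℝ ι) ∩ {p | ∀ i, (B *ᵥ p.2) i ≤ p.1 * p.2 i}
  have hS : IsCompact S := by
    refine (isCompact_Icc.prod (isCompact_stdSimplex ℝ ι)).inter_right ?_
    simp only [Set.ofPred_forall]
    refine isClosed_iInter fun i => isClosed_le ?_ ?_
    · exact (continuous_apply i).comp (Continuous.matrix_mulVec continuous_const continuous_snd)
    · fun_prop
  have hone : S.Nonempty := by
    have hN : (0 : ℝ) < Fintype.card ι := by exact_mod_cast Fintype.card_pos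
    refine ⟨(R, fun _ => (Fintype.card ι : ℝ)⁻¹), ⟨⟨⟨?_, le_rfl⟩, ⟨fun _ => by positivity, ?_⟩⟩, ?_⟩⟩
    · exact Finset.sum_nonneg fun i _ => Finset.sum_nonneg fun j _ => hB.nonneg i j
    · simp [hN.ne']
    · intro i
      simp only [mulVec, dotProduct, ← Finset.sum_mul]
      gcongr
      exact Finset.single_le_sum (f := fun i => ∑ j, B i j)
        (fun i _ => Finset.sum_nonneg fun j _ => hB.nonneg i j) (Finset.mem_univ i)
  obtain ⟨⟨r, x⟩, ⟨⟨⟨hr0, hrR⟩, hx, hx1⟩, hBx⟩, hmin⟩ :=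
    hS.exists_isMinOn hone continuous_fst.continuousOn
  simp only at hr0 hrR hx hx1 hBx
  have hx0 : x ≠ 0 := by rintro rfl; simp at hx1
  have hxpos := pos_of_mulVec_le hB hx hx0 hBx
  refine ⟨r, x, hxpos, ?_⟩
  by_contra hne
  let z : ι → ℝ := r • x - B *ᵥ x
  have hz : ∀ i, 0 ≤ z i := fun i => sub_nonneg.2 (hBx i)
  obtain ⟨j, hj⟩ := Function.ne_iff.1 (sub_ne_zero.2 (Ne.symm hne) : z ≠ 0)
  have hj : 0 < z j := lt_of_le_of_ne (hz j) (Ne.symm hj)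
  obtain ⟨P, hcomm, hP⟩ := exists_commute_pos hB
  let w : ι → ℝ := P *ᵥ x
  have hw : ∀ i, 0 < w i := fun i =>
    mulVec_pos_apply (fun l => (hP i l).le) hx (hP i j) (hxpos j)
  have hBw : ∀ i, (B *ᵥ w) i < r * w i := fun i => by
    have h1 : 0 < (P *ᵥ z) i := mulVec_pos_apply (fun l => (hP i l).le) hz (hP i j) hj
    have h2 : P *ᵥ z = r • w - B *ᵥ w := by
      simp only [z, w, mulVec_sub, mulVec_smul, mulVec_mulVec, hcomm.eq]
    rw [h2] at h1
    simpa using h1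
  obtain ⟨t, i, hle, heq⟩ := exists_le_mul_eq hw (B *ᵥ w)
  have htr : t < r := lt_of_mul_lt_mul_right (heq ▸ hBw i) (hw i).le
  have ht0 : 0 ≤ t := by
    have := mulVec_nonneg_apply hB.nonneg (fun i => (hw i).le) i
    rw [heq] at this
    exact nonneg_of_mul_nonneg_left this (hw i)
  have hsum : 0 < ∑ i, w i := Finset.sum_pos (fun i _ => hw i) Finset.univ_nonempty
  have hmem : (t, (∑ i, w i)⁻¹ • w) ∈ S := by
    refine ⟨⟨⟨ht0, htr.le.trans hrR⟩, ⟨fun i => ?_, ?_⟩⟩, fun i => ?_⟩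
    · exact mul_nonneg (inv_nonneg.2 hsum.le) (hw i).le
    · simp [← Finset.mul_sum, hsum.ne']
    · simp only [mulVec_smul, Pi.smul_apply, smul_eq_mul]
      have := mul_le_mul_of_nonneg_left (hle i) (inv_nonneg.2 hsum.le)
      linarith
  exact absurd (hmin hmem) (not_le.2 htr)

/-- An eigenvalue with a positive eigenvector is the spectral radius: the entrywise modulus `|u|`
of a complex eigenvector for `μ` satisfies `|μ| |u| ≤ B |u|`, which is compared with the positive
eigenvector where `|u| / v` is largest. -/
theorem spectralRadius_eq_of_eigenvector [Nonempty ι] (hB : ∀ i j, 0 ≤ B i j) {r : ℝ} {v : ι → ℝ}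
    (hvpos : ∀ i, 0 < v i) (hv : B *ᵥ v = r • v) :
    (spectralRadius ℂ (B.map (algebraMap ℝ ℂ))).toReal = r := by
  obtain ⟨i₀⟩ := ‹Nonempty ι›
  have : Nonempty ι := ⟨i₀⟩
  have hr0 : 0 ≤ r := by
    have := mulVec_nonneg_apply hB (fun i => (hvpos i).le) i₀
    rw [hv] at this
    exact nonneg_of_mul_nonneg_left this (hvpos i₀)
  have hspec : ∀ μ : ℂ, μ ∈ spectrum ℂ (B.map (algebraMap ℝ ℂ)) ↔
      ∃ u : ι → ℂ, u ≠ 0 ∧ B.map (algebraMap ℝ ℂ) *ᵥ u = μ • u := by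
    intro μ
    rw [spectrum.mem_iff, Matrix.isUnit_iff_isUnit_det, isUnit_iff_ne_zero, not_not,
      ← exists_mulVec_eq_zero_iff]
    simp only [sub_mulVec, sub_eq_zero, Algebra.algebraMap_eq_smul_one, smul_mulVec, one_mulVec,
      eq_comm]
  have hle : ∀ μ ∈ spectrum ℂ (B.map (algebraMap ℝ ℂ)), ‖μ‖ ≤ r := by
    intro μ hμ
    obtain ⟨u, hu0, hu⟩ := (hspec μ).1 hμ
    obtain ⟨t, i, hle, heq⟩ := exists_le_mul_eq hvpos fun j => ‖u j‖
    have ht : 0 < t := by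
      obtain ⟨j, hj⟩ := Function.ne_iff.1 hu0
      have := (norm_pos_iff.2 hj).trans_le (hle j)
      exact pos_of_mul_pos_left this (hvpos j).le
    have h1 : ‖μ‖ * ‖u i‖ ≤ (B *ᵥ fun j => ‖u j‖) i := by
      have h2 := congrFun hu i
      rw [← norm_mul]
      change _ = μ * u i at h2
      rw [← h2]
      refine (norm_sum_le _ _).trans (Finset.sum_le_sum fun j _ => ?_)
      simp [abs_of_nonneg (hB i j)]
    have h3 := h1.trans (mulVec_mono_apply hB hle i)
    rw [mulVec_mul_apply_of_eigenvector hv, heq] at h3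
    have h4 : 0 < t * v i := mul_pos ht (hvpos i)
    nlinarith
  have hmem : (r : ℂ) ∈ spectrum ℂ (B.map (algebraMap ℝ ℂ)) := by
    refine (hspec _).2 ⟨fun i => (v i : ℂ), fun h => (hvpos i₀).ne' ?_, funext fun i => ?_⟩
    · simpa using congrFun h i₀
    · have := congrArg (algebraMap ℝ ℂ) (congrFun hv i)
      simpa [mulVec, dotProduct] using this
  have : spectralRadius ℂ (B.map (algebraMap ℝ ℂ)) = ENNReal.ofReal r := by
    refine le_antisymm (iSup₂_le fun μ hμ => ?_) ?_
    · rw [← enorm_eq_nnnorm, ← ofReal_norm]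
      exact ENNReal.ofReal_le_ofReal (hle μ hμ)
    · refine le_trans (le_of_eq ?_) (le_iSup₂ (r : ℂ) hmem)
      rw [← enorm_eq_nnnorm, ← ofReal_norm]
      simp [abs_of_nonneg hr0]
  rw [this, ENNReal.toReal_ofReal hr0]

/-- The solutions of `B x ≤ r x` are multiples of the Perron vector: subtracting the largest
multiple of `v` below `x` leaves a nonnegative solution with a zero entry. -/
theorem exists_eq_smul_of_mulVec_le [Nonempty ι] (hB : B.IsIrreducible) {r : ℝ} {v : ι → ℝ}
    (hvpos : ∀ i, 0 < v i) (hv : B *ᵥ v = r • v) {x : ι → ℝ}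
    (h : ∀ i, (B *ᵥ x) i ≤ r * x i) : ∃ s : ℝ, x = s • v := by
  obtain ⟨s, i, hle, heq⟩ := exists_mul_le_eq hvpos x
  refine ⟨s, ?_⟩
  by_contra hne
  have := pos_of_mulVec_le hB (z := x - s • v) (l := r) (fun j => sub_nonneg.2 (hle j))
    (sub_ne_zero.2 hne) (fun j => ?_) i
  · simp [heq] at this
  · have := h j
    simp only [mulVec_sub, mulVec_smul, hv, Pi.sub_apply, Pi.smul_apply, smul_eq_mul]
    linarith

end Perron

/-! ### The inner linear system -/

section InnerSystem

variable {ι : Type*} [Fintype ι] [Nonempty ι] {B : Matrix ι ι ℝ} {r l : ℝ}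
  {v y g : ι → ℝ}

/-- At the Perron root `r` the system `(r I - B) y = g` has no solution for positive `g`: where
`y / v` is smallest, the entry of `(r I - B) y` is at most `0`. -/
lemma lt_of_inner_system (hB : ∀ i j, 0 ≤ B i j) (hvpos : ∀ i, 0 < v i) (hv : B *ᵥ v = r • v)
    (hl : r ≤ l) (hy : ∀ i, (B *ᵥ y) i = l * y i - g i) (hg : ∀ i, 0 < g i) : r < l := by
  refine lt_of_le_of_ne hl ?_
  rintro rfl
  obtain ⟨s, i, hle, heq⟩ := exists_mul_le_eq hvpos y
  have h1 := mulVec_mono_apply hB hle i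
  rw [mulVec_mul_apply_of_eigenvector hv, hy, heq] at h1
  nlinarith [hg i]

lemma pos_of_inner_system (hB : ∀ i j, 0 ≤ B i j) (hvpos : ∀ i, 0 < v i) (hv : B *ᵥ v = r • v)
    (hl : r < l) (hy : ∀ i, (B *ᵥ y) i = l * y i - g i) (hg : ∀ i, 0 < g i) (i : ι) :
    0 < y i := by
  obtain ⟨s, j, hle, heq⟩ := exists_mul_le_eq hvpos y
  have h1 := mulVec_mono_apply hB hle j
  rw [mulVec_mul_apply_of_eigenvector hv, hy, heq] at h1
  have h2 : 0 < s * ((l - r) * v j) := by nlinarith [hg j]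
  have h3 : 0 < s := pos_of_mul_pos_left h2 (mul_pos (sub_pos.2 hl) (hvpos j)).le
  exact (mul_pos h3 (hvpos i)).trans_le (hle i)

/-- The solution of `(l I - B) y = g` is at most `b / (l - r)` times the Perron vector if `g` is
at most `b` times it. -/
lemma le_of_inner_system (hB : ∀ i j, 0 ≤ B i j) (hvpos : ∀ i, 0 < v i) (hv : B *ᵥ v = r • v)
    (hl : r < l) (hy : ∀ i, (B *ᵥ y) i = l * y i - g i) {b : ℝ} (hg : ∀ i, g i ≤ b * v i)
    (i : ι) : (l - r) * y i ≤ b * v i := by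
  obtain ⟨t, j, hle, heq⟩ := exists_le_mul_eq hvpos y
  have h1 := mulVec_mono_apply hB hle j
  rw [mulVec_mul_apply_of_eigenvector hv, hy, heq] at h1
  have h2 : (l - r) * t ≤ b := by
    refine le_of_mul_le_mul_right ?_ (hvpos j)
    nlinarith [hg j]
  calc (l - r) * y i ≤ (l - r) * (t * v i) :=
        mul_le_mul_of_nonneg_left (hle i) (sub_pos.2 hl).le
    _ = (l - r) * t * v i := by ring
    _ ≤ b * v i := mul_le_mul_of_nonneg_right h2 (hvpos i).le

end InnerSystem

/-! ### Normalized subinvariant vectors -/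

section Subinvariant

variable {n : ℕ} {B : Matrix (Fin n) (Fin n) ℝ}

lemma abs_apply_le_norm2 (v : Fin n → ℝ) (i : Fin n) : |v i| ≤ norm2 v :=
  PiLp.norm_apply_le (WithLp.toLp 2 v) i

lemma norm2_smul (c : ℝ) (v : Fin n → ℝ) : norm2 (c • v) = |c| * norm2 v := by
  simp [norm2, WithLp.toLp_smul, norm_smul]

lemma continuous_norm2 : Continuous (norm2 : (Fin n → ℝ) → ℝ) :=
  (PiLp.continuous_toLp 2 _).norm

lemma norm2_pos_of_pos [Nonempty (Fin n)] {v : Fin n → ℝ} (hv : ∀ i, 0 < v i) : 0 < norm2 v :=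
  let i := Classical.arbitrary (Fin n)
  (abs_pos.2 (hv i).ne').trans_le (abs_apply_le_norm2 v i)

/-- The nonnegative Euclidean unit vectors `x` with `B x ≤ l x`. Every iterate of the inexact Noda
iteration lies in this set for `l = lam 0`. -/
def subinvariant (B : Matrix (Fin n) (Fin n) ℝ) (l : ℝ) : Set (Fin n → ℝ) :=
  {x | norm2 x = 1 ∧ (∀ i, 0 ≤ x i) ∧ ∀ i, (B *ᵥ x) i ≤ l * x i}

lemma isClosed_mulVec_le (B : Matrix (Fin n) (Fin n) ℝ) (l : ℝ) :
    IsClosed {x : Fin n → ℝ | ∀ i, (B *ᵥ x) i ≤ l * x i} := by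
  simp only [Set.ofPred_forall]
  refine isClosed_iInter fun i => isClosed_le ?_ (by fun_prop)
  exact (continuous_apply i).comp (Continuous.matrix_mulVec continuous_const continuous_id)

lemma subinvariant_mono {l l' : ℝ} (h : l ≤ l') : subinvariant B l ⊆ subinvariant B l' :=
  fun _ hz => ⟨hz.1, hz.2.1, fun i => (hz.2.2 i).trans (mul_le_mul_of_nonneg_right h (hz.2.1 i))⟩

lemma apply_le_one_of_norm2_eq {x : Fin n → ℝ} (h : norm2 x = 1) (i : Fin n) : x i ≤ 1 :=
  (le_abs_self _).trans ((abs_apply_le_norm2 x i).trans h.le)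

lemma isCompact_subinvariant (B : Matrix (Fin n) (Fin n) ℝ) (l : ℝ) :
    IsCompact (subinvariant B l) := by
  refine (isCompact_Icc (a := (0 : Fin n → ℝ)) (b := 1)).of_isClosed_subset ?_
    fun x hx => ⟨hx.2.1, apply_le_one_of_norm2_eq hx.1⟩
  refine (isClosed_eq continuous_norm2 continuous_const).inter
    (IsClosed.inter ?_ (isClosed_mulVec_le B l))
  exact isClosed_Ici (a := (0 : Fin n → ℝ))

lemma subinvariant_pos (hB : B.IsIrreducible) {l : ℝ} {x : Fin n → ℝ} (hx : x ∈ subinvariant B l)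
    (i : Fin n) : 0 < x i := by
  refine pos_of_mulVec_le hB hx.2.1 ?_ hx.2.2 i
  rintro rfl
  simpa [norm2] using hx.1

/-- The entries of the vectors in `subinvariant B l` are bounded away from `0`: the product of the
entries is continuous and positive on this compact set, and bounds each entry from below since no
entry exceeds `1`. -/
lemma exists_pos_le_of_subinvariant (hB : B.IsIrreducible) (l : ℝ) :
    ∃ m > 0, ∀ x ∈ subinvariant B l, ∀ i, m ≤ x i := by
  rcases (subinvariant B l).eq_empty_or_nonempty with h | h
  · exact ⟨1, one_pos, by simp [h]⟩
  obtain ⟨x₀, hx₀, hmin⟩ := (isCompact_subinvariant B l).exists_isMinOn h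
    (f := fun x => ∏ i, x i) (by fun_prop)
  refine ⟨∏ i, x₀ i, Finset.prod_pos fun i _ => subinvariant_pos hB hx₀ i, fun x hx i => ?_⟩
  refine (hmin hx).trans ?_
  change ∏ j, x j ≤ x i
  rw [← Finset.mul_prod_erase _ _ (Finset.mem_univ i)]
  exact mul_le_of_le_one_right (hx.2.1 i)
    (Finset.prod_le_one (fun j _ => hx.2.1 j) fun j _ => apply_le_one_of_norm2_eq hx.1 j)

/-- Unit vectors `x k ≥ 0` with `B (x k) ≤ lam k • x k` and `lam k → r` converge to the normalized
Perron vector, since a cluster point `z` satisfies `B z ≤ r z`. -/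
lemma tendsto_perron_vector [Nonempty (Fin n)] (hB : B.IsIrreducible) {r L : ℝ} {v : Fin n → ℝ}
    (hvpos : ∀ i, 0 < v i) (hv1 : norm2 v = 1) (hv : B *ᵥ v = r • v) {x : ℕ → Fin n → ℝ}
    {lam : ℕ → ℝ} (hlam : Tendsto lam atTop (𝓝 r)) (hL : ∀ k, lam k ≤ L)
    (hx : ∀ k, x k ∈ subinvariant B (lam k)) : Tendsto x atTop (𝓝 v) := by
  refine (isCompact_subinvariant B L).tendsto_nhds_of_unique_mapClusterPt
    (Eventually.of_forall fun k => subinvariant_mono (hL k) (hx k)) fun z hz hclus => ?_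
  have h1 : ∀ δ > 0, ∀ i, (B *ᵥ z) i ≤ (r + δ) * z i := fun δ hδ => by
    refine (isClosed_mulVec_le B (r + δ)).mem_of_mapClusterPt hclus ?_
    filter_upwards [hlam.eventually_le_const (lt_add_of_pos_right r hδ)] with k hk
    exact (subinvariant_mono hk (hx k)).2.2
  have h2 : ∀ i, (B *ᵥ z) i ≤ r * z i := fun i => by
    refine le_of_forall_pos_le_add fun δ hδ => (h1 δ hδ i).trans ?_
    nlinarith [apply_le_one_of_norm2_eq hz.1 i]
  obtain ⟨s, rfl⟩ := exists_eq_smul_of_mulVec_le hB hvpos hv h2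
  have hs : 0 ≤ s := nonneg_of_mul_nonneg_left (hz.2.1 (Classical.arbitrary _)) (hvpos _)
  have := hz.1
  rw [norm2_smul, hv1, mul_one, abs_of_nonneg hs] at this
  rw [this, one_smul]

end Subinvariant

/-! ### The iteration -/

section Iteration

variable {n : ℕ} {B : Matrix (Fin n) (Fin n) ℝ} {γ r : ℝ}
  {x y f : ℕ → Fin n → ℝ} {lam : ℕ → ℝ} {v : Fin n → ℝ}

lemma minQuot_le (w u : Fin n → ℝ) (i : Fin n) : minQuot w u ≤ w i / u i :=
  ciInf_le (Set.finite_range _).bddBelow i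

lemma IsINI1.mulVec_succ (hrun : IsINI1 B γ x y f lam) (k : ℕ) (i : Fin n) :
    (B *ᵥ y (k + 1)) i = lam k * y (k + 1) i - (x k + f k) i := by
  rw [← hrun.inner_system k]
  simp [sub_mulVec, smul_mulVec]

lemma IsINI1.abs_f_le (hrun : IsINI1 B γ x y f lam) (hγ0 : 0 < γ) (k : ℕ) (i : Fin n) :
    |f k i| ≤ γ * x k i :=
  (abs_apply_le_norm2 _ i).trans ((hrun.inner_tol k).trans
    (mul_le_mul_of_nonneg_left (ciInf_le (Set.finite_range _).bddBelow i) hγ0.le))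

lemma IsINI1.rhs_pos (hrun : IsINI1 B γ x y f lam) (hγ0 : 0 < γ) (hγ1 : γ < 1) {k : ℕ}
    (hx : ∀ i, 0 < x k i) (i : Fin n) : 0 < (x k + f k) i := by
  have h1 := (abs_le.1 (hrun.abs_f_le hγ0 k i)).1
  rw [Pi.add_apply]
  nlinarith [hx i]

variable [Nonempty (Fin n)]

/-- The iterates are positive unit vectors with `B (x k) ≤ lam k • x k`, and `lam k` exceeds the
Perron root. Strictness is forced by the solvability of the `k`-th inner system, whose right-hand
side is positive. -/
theorem IsINI1.invariant (hB : B.IsIrreducible) (hγ0 : 0 < γ) (hγ1 : γ < 1)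
    (hrun : IsINI1 B γ x y f lam) (hvpos : ∀ i, 0 < v i) (hv : B *ᵥ v = r • v) (k : ℕ) :
    (∀ i, 0 < x k i) ∧ x k ∈ subinvariant B (lam k) ∧ r < lam k := by
  have step : ∀ k, (∀ i, 0 < x k i) → x k ∈ subinvariant B (lam k) → r < lam k :=
    fun k hpos hk => lt_of_inner_system hB.nonneg hvpos hv
      (le_of_mulVec_le hB.nonneg hvpos hv hpos hk.2.2) (hrun.mulVec_succ k)
      (hrun.rhs_pos hγ0 hγ1 hpos)
  suffices h : (∀ i, 0 < x k i) ∧ x k ∈ subinvariant B (lam k) from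
    ⟨h.1, h.2, step k h.1 h.2⟩
  induction k with
  | zero =>
    refine ⟨hrun.x_zero_pos, hrun.x_zero_unit, fun i => (hrun.x_zero_pos i).le, fun i => ?_⟩
    rw [← div_le_iff₀ (hrun.x_zero_pos i), hrun.lam_zero]
    exact le_ciSup (f := fun i => (B *ᵥ x 0) i / x 0 i) (Set.finite_range _).bddAbove i
  | succ k ih =>
    have hy := pos_of_inner_system hB.nonneg hvpos hv (step k ih.1 ih.2) (hrun.mulVec_succ k)
      (hrun.rhs_pos hγ0 hγ1 ih.1)
    have hN := norm2_pos_of_pos hy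
    have hpos : ∀ i, 0 < x (k + 1) i := fun i => by
      rw [hrun.normalize]
      exact mul_pos (inv_pos.2 hN) (hy i)
    refine ⟨hpos, ?_, fun i => (hpos i).le, fun i => ?_⟩
    · rw [hrun.normalize, norm2_smul, abs_of_pos (inv_pos.2 hN), inv_mul_cancel₀ hN.ne']
    · rw [hrun.normalize, mulVec_smul, Pi.smul_apply, Pi.smul_apply, smul_eq_mul, smul_eq_mul,
        hrun.mulVec_succ, mul_left_comm]
      refine mul_le_mul_of_nonneg_left ?_ (inv_pos.2 hN).le
      have := (le_div_iff₀ (hy i)).1 (minQuot_le (x k + f k) (y (k + 1)) i)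
      rw [hrun.lam_succ]
      linarith

/-- The one-step contraction: the closer `x k` is to a multiple of the Perron vector, as measured
by `a v ≤ x k ≤ b v`, the closer the contraction factor is to `1 - (1 - γ) / (1 + γ)`. -/
theorem IsINI1.contraction (hB : B.IsIrreducible) (hγ0 : 0 < γ) (hγ1 : γ < 1)
    (hrun : IsINI1 B γ x y f lam) (hvpos : ∀ i, 0 < v i) (hv : B *ᵥ v = r • v) (k : ℕ)
    {a b : ℝ} (ha : ∀ i, a * v i ≤ x k i) (hb : ∀ i, x k i ≤ b * v i) :
    lam (k + 1) - r ≤ (1 - (1 - γ) / (1 + γ) * (a / b)) * (lam k - r) := by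
  obtain ⟨hpos, -, hr⟩ := hrun.invariant hB hγ0 hγ1 hvpos hv k
  have hrhs := hrun.rhs_pos hγ0 hγ1 hpos
  have hy := pos_of_inner_system hB.nonneg hvpos hv hr (hrun.mulVec_succ k) hrhs
  have hyb := le_of_inner_system hB.nonneg hvpos hv hr (hrun.mulVec_succ k)
    (b := (1 + γ) * b) fun i => by
      have h1 := (abs_le.1 (hrun.abs_f_le hγ0 k i)).2
      have h2 := hb i
      rw [Pi.add_apply]
      nlinarith
  have hb0 : 0 < b := by
    let i := Classical.arbitrary (Fin n)
    exact pos_of_mul_pos_left ((hpos i).trans_le (hb i)) (hvpos i).le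
  have hε : 0 < lam k - r := sub_pos.2 hr
  have key : (1 - γ) / (1 + γ) * (a / b) * (lam k - r) ≤ minQuot (x k + f k) (y (k + 1)) := by
    refine le_ciInf fun i => ?_
    rw [le_div_iff₀ (hy i), Pi.add_apply]
    have h1 := (abs_le.1 (hrun.abs_f_le hγ0 k i)).1
    rcases le_or_gt a 0 with ha0 | ha0
    · refine le_trans ?_ (hrhs i).le
      have : (1 - γ) / (1 + γ) * (a / b) ≤ 0 :=
        mul_nonpos_of_nonneg_of_nonpos (div_nonneg (by linarith) (by linarith))
          (div_nonpos_of_nonpos_of_nonneg ha0 hb0.le)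
      exact mul_nonpos_of_nonpos_of_nonneg (mul_nonpos_of_nonpos_of_nonneg this hε.le) (hy i).le
    · calc (1 - γ) / (1 + γ) * (a / b) * (lam k - r) * y (k + 1) i
          = (1 - γ) / (1 + γ) * (a / b) * ((lam k - r) * y (k + 1) i) := by ring
        _ ≤ (1 - γ) / (1 + γ) * (a / b) * ((1 + γ) * b * v i) := by
            refine mul_le_mul_of_nonneg_left (hyb i) ?_
            exact mul_nonneg (div_nonneg (by linarith) (by linarith)) (by positivity)
        _ = (1 - γ) * (a * v i) := by field_simp
        _ ≤ (1 - γ) * x k i := mul_le_mul_of_nonneg_left (ha i) (by linarith)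
        _ ≤ x k i + f k i := by linarith
  rw [hrun.lam_succ]
  linarith

/-- Convergence with some linear rate: compactness bounds `a / b` in the one-step contraction away
from `0`. -/
theorem IsINI1.tendsto_lam (hB : B.IsIrreducible) (hγ0 : 0 < γ) (hγ1 : γ < 1)
    (hrun : IsINI1 B γ x y f lam) (hvpos : ∀ i, 0 < v i) (hv1 : norm2 v = 1)
    (hv : B *ᵥ v = r • v) : Tendsto lam atTop (𝓝 r) ∧ ∀ k, lam k ≤ lam 0 := by
  have hinv := hrun.invariant hB hγ0 hγ1 hvpos hv
  -- The lower bound `a = 0` already gives monotonicity.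
  have hanti : Antitone lam := antitone_nat_of_succ_le fun k => by
    have := hrun.contraction hB hγ0 hγ1 hvpos hv k (a := 0) (b := ∑ i, x k i / v i)
      (by simpa using fun i => ((hinv k).1 i).le) fun i => by
        rw [← div_le_iff₀ (hvpos i)]
        exact Finset.single_le_sum (f := fun i => x k i / v i)
          (fun j _ => (div_pos ((hinv k).1 j) (hvpos j)).le) (Finset.mem_univ i)
    simpa using this
  have hle : ∀ k, lam k ≤ lam 0 := fun k => hanti (Nat.zero_le k)
  refine ⟨?_, hle⟩
  obtain ⟨m, hm, hmx⟩ := exists_pos_le_of_subinvariant hB (lam 0)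
  have hmv : ∀ i, m ≤ v i := hmx v ⟨hv1, fun i => (hvpos i).le, fun i => by
    rw [hv]
    exact mul_le_mul_of_nonneg_right (hinv 0).2.2.le (hvpos i).le⟩
  -- All entries of `x k` and `v` lie in `[m, 1]`, so `m v ≤ x k ≤ m⁻¹ v`.
  set q := 1 - (1 - γ) / (1 + γ) * (m / m⁻¹) with hq
  have hm1 : m ≤ 1 :=
    (hmv (Classical.arbitrary _)).trans (apply_le_one_of_norm2_eq hv1 _)
  have hstep : ∀ k, lam (k + 1) - r ≤ q * (lam k - r) := fun k => by
    refine hrun.contraction hB hγ0 hγ1 hvpos hv k (fun i => ?_) fun i => ?_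
    · exact (mul_le_of_le_one_right hm.le (apply_le_one_of_norm2_eq hv1 i)).trans
        (hmx _ (subinvariant_mono (hle k) (hinv k).2.1) i)
    · refine (apply_le_one_of_norm2_eq (hinv k).2.1.1 i).trans ?_
      rw [← div_eq_inv_mul, one_le_div hm]
      exact hmv i
  have hq1 : q < 1 := by
    have : 0 < (1 - γ) / (1 + γ) * (m / m⁻¹) :=
      mul_pos (div_pos (by linarith) (by linarith)) (by positivity)
    linarith
  have hq0 : 0 ≤ q := by
    have h := (sub_pos.2 (hinv 1).2.2).trans_le (hstep 0)
    exact (pos_of_mul_pos_left h (sub_pos.2 (hinv 0).2.2).le).le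
  have hgeo : ∀ k, lam k - r ≤ q ^ k * (lam 0 - r) := fun k => by
    induction k with
    | zero => simp
    | succ k ih =>
      calc lam (k + 1) - r ≤ q * (lam k - r) := hstep k
        _ ≤ q * (q ^ k * (lam 0 - r)) := mul_le_mul_of_nonneg_left ih hq0
        _ = q ^ (k + 1) * (lam 0 - r) := by ring
  rw [← tendsto_sub_nhds_zero_iff]
  refine squeeze_zero (fun k => (sub_pos.2 (hinv k).2.2).le) hgeo ?_
  simpa using (tendsto_pow_atTop_nhds_zero_of_lt_one hq0 hq1).mul_const (lam 0 - r)

/-- The asymptotic rate: `x k` converges to the Perron vector, so for every `δ > 0` the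
one-step contraction eventually applies with `a = 1 - δ` and `b = 1 + δ`. -/
theorem IsINI1.eventually_le (hB : B.IsIrreducible) (hγ0 : 0 < γ) (hγ1 : γ < 1)
    (hrun : IsINI1 B γ x y f lam) (hvpos : ∀ i, 0 < v i) (hv1 : norm2 v = 1)
    (hv : B *ᵥ v = r • v) {q : ℝ} (hq : 2 * γ / (1 + γ) < q) :
    ∀ᶠ k in atTop, lam (k + 1) - r ≤ q * (lam k - r) := by
  have hinv := hrun.invariant hB hγ0 hγ1 hvpos hv
  obtain ⟨hlam, hle⟩ := hrun.tendsto_lam hB hγ0 hγ1 hvpos hv1 hv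
  have hx := tendsto_perron_vector hB hvpos hv1 hv hlam hle fun k => (hinv k).2.1
  have hcont : Tendsto (fun δ : ℝ => 1 - (1 - γ) / (1 + γ) * ((1 - δ) / (1 + δ))) (𝓝[>] 0)
      (𝓝 (2 * γ / (1 + γ))) := by
    have h0 : ContinuousAt (fun δ : ℝ => 1 - (1 - γ) / (1 + γ) * ((1 - δ) / (1 + δ))) 0 := by
      refine continuousAt_const.sub (continuousAt_const.mul (ContinuousAt.div ?_ ?_ (by simp)))
        <;> fun_prop
    have h1 : (1 : ℝ) - (1 - γ) / (1 + γ) * ((1 - 0) / (1 + 0)) = 2 * γ / (1 + γ) := by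
      field_simp
      ring
    have h2 := h0.tendsto
    rw [h1] at h2
    exact h2.mono_left nhdsWithin_le_nhds
  obtain ⟨δ, hδq, hδ⟩ := ((hcont.eventually_lt_const hq).and self_mem_nhdsWithin).exists
  have hδ : 0 < δ := hδ
  have hlow : ∀ᶠ k in atTop, ∀ i, (1 - δ) * v i ≤ x k i := eventually_all.2 fun i =>
    (tendsto_pi_nhds.1 hx i).eventually_const_le (by nlinarith [hvpos i])
  have hupp : ∀ᶠ k in atTop, ∀ i, x k i ≤ (1 + δ) * v i := eventually_all.2 fun i =>
    (tendsto_pi_nhds.1 hx i).eventually_le_const (by nlinarith [hvpos i])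
  filter_upwards [hlow, hupp] with k ha hb
  exact (hrun.contraction hB hγ0 hγ1 hvpos hv k ha hb).trans
    (mul_le_mul_of_nonneg_right hδq.le (sub_pos.2 (hinv k).2.2).le)

end Iteration

end Noda

theorem theorem2 {n : ℕ} (B : Matrix (Fin n) (Fin n) ℝ) (hB : B.IsIrreducible)
    (γ : ℝ) (hγ0 : 0 < γ) (hγ1 : γ < 1)
    (x y f : ℕ → Fin n → ℝ) (lam : ℕ → ℝ) (hrun : Noda.IsINI1 B γ x y f lam) :
    (∀ k, 0 < Noda.err B lam k) ∧
    limsup (fun k => (Noda.ratio B lam k : EReal)) atTop ≤ ((2 * γ / (1 + γ) : ℝ) : EReal) ∧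
    2 * γ / (1 + γ) < 1 ∧
    Tendsto lam atTop (𝓝 (Noda.rho B)) ∧
    ∀ q : ℝ, 2 * γ / (1 + γ) < q →
      ∀ᶠ k in atTop, Noda.err B lam (k + 1) ≤ q * Noda.err B lam k := by
  -- In dimension zero there is no unit vector to start from.
  have : Nonempty (Fin n) := by
    by_contra h
    have := not_nonempty_iff.1 h
    have h1 := hrun.x_zero_unit
    have h2 : x 0 = 0 := Subsingleton.elim _ _
    simp [Noda.norm2, h2] at h1
  obtain ⟨r, u, hu, hBu⟩ := Noda.exists_perron_vector hB
  have hr : Noda.rho B = r := Noda.spectralRadius_eq_of_eigenvector hB.nonneg hu hBu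
  obtain ⟨v, hvpos, hv1, hv⟩ : ∃ v : Fin n → ℝ,
      (∀ i, 0 < v i) ∧ Noda.norm2 v = 1 ∧ B *ᵥ v = r • v := by
    have hN := Noda.norm2_pos_of_pos hu
    refine ⟨(Noda.norm2 u)⁻¹ • u, fun i => mul_pos (inv_pos.2 hN) (hu i), ?_, ?_⟩
    · rw [Noda.norm2_smul, abs_of_pos (inv_pos.2 hN), inv_mul_cancel₀ hN.ne']
    · rw [mulVec_smul, hBu, smul_comm]
  have herr : ∀ k, 0 < Noda.err B lam k := fun k => by
    rw [Noda.err, hr]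
    exact sub_pos.2 (hrun.invariant hB hγ0 hγ1 hvpos hv k).2.2
  have hrate : ∀ q : ℝ, 2 * γ / (1 + γ) < q →
      ∀ᶠ k in atTop, Noda.err B lam (k + 1) ≤ q * Noda.err B lam k := fun q hq => by
    simp only [Noda.err, hr]
    exact hrun.eventually_le hB hγ0 hγ1 hvpos hv1 hv hq
  refine ⟨herr, ?_, ?_, ?_, hrate⟩
  · refine EReal.le_of_forall_lt_iff_le.1 fun q hq => ?_
    refine limsup_le_of_le (by isBoundedDefault) ?_
    filter_upwards [hrate q (EReal.coe_lt_coe_iff.1 hq)] with k hk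
    exact EReal.coe_le_coe_iff.2 ((div_le_iff₀ (herr k)).2 hk)
  · rw [div_lt_one (by linarith)]
    linarith
  · rw [hr]
    exact (hrun.tendsto_lam hB hγ0 hγ1 hvpos hv1 hv).1
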